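/- For a real random variable $X$ let $\|X\|_{\varphi_2}=\sup_{p\ge 1}p^{-1/2}(\mathbb E|X|^p)^{1/p}$ be its sub-Gaussian norm. For matrices $A\in\mathbb R^{d_1\times k}$, $B\in\mathbb R^{d_2\times k}$ let $A\odot B\in\mathbb R^{d_1d_2\times k}$ be their Khatri--Rao product, whose $i$-th column is the Kronecker product of the $i$-th columns of $A$ and $B$. The order-2 tensor random projection (TRP) with range $k$ is $f_{\mathrm{TRP}}(x)=\frac1{\sqrt k}(A\odot B)^{\top}x$ for $x\in\mathbb R^{d_1d_2}$, and for $T\ge 1$ replicates the map TRP($T$) is $f_{\mathrm{TRP}(T)}(x)=\frac1{\sqrt T}\sum_{t=1}^T\frac1{\sqrt k}(A^{(t)}\odot B^{(t)})^{\top}x$, so that TRP(1) is the TRP. There is a universal constant $c_1>0$, and for every $\varphi_2>0$ a constant $C>0$ depending only on $\varphi_2$, such that the following holds for all integers $d_1,d_2\ge 1$ and $k,T\ge1$ and every fixed nonzero $x\in\mathbb R^{d_1d_2}$. Let all entries of the matrices $A^{(t)}\in\mathbb R^{d_1\times k}$, $B^{(t)}\in\mathbb R^{d_2\times k}$, $1\le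 t\le T$, be drawn i.i.d. from a distribution with mean zero, variance one and sub-Gaussian norm at most $\varphi_2$. Then for every $0<\epsilon\le 1$ $$\mathbb P\left(\left|\|f_{\mathrm{TRP}(T)}(x)\|^2-\|x\|^2\right|\ge\epsilon\|x\|^2\right)\le C\exp\left[-c_1\left(\sqrt k\,\epsilon\right)^{1/2}\right],$$ and for every $\epsilon>0$ $$\mathbb P\left(\left|\|f_{\mathrm{TRP}(T)}(x)\|^2-\|x\|^2\right|\ge\epsilon\|x\|^2\right)\le C\exp\left[-\frac{c_1}{\varphi_2^2}\left(\sqrt k\,\epsilon\right)^{1/2}\right].$$ In particular ($T=1$) both bounds hold for $f_{\mathrm{TRP}}$. -/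

import Mathlib

open MeasureTheory ProbabilityTheory
open scoped ENNReal Matrix

noncomputable section

/-- The sub-Gaussian norm `sup_{p ≥ 1} p^{-1/2} (E|X|^p)^{1/p}` of a real random variable `X`,
as an extended nonnegative number; `X` is sub-Gaussian when it is finite. -/
def subGaussianNorm {Ω : Type*} [MeasurableSpace Ω] (X : Ω → ℝ) (μ : Measure Ω) : ℝ≥0∞ :=
  ⨆ (p : ℝ) (_ : 1 ≤ p), ENNReal.ofReal (p ^ (-(1 / 2) : ℝ)) * eLpNorm X (ENNReal.ofReal p) μ

/-- The Khatri–Rao (column-wise Kronecker) product of an `I × K` and a `J × K` matrix.  Its rows are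
indexed by the pairs `(i, j)`, in the place of `1, …, IJ`. -/
def khatriRao {I J K : Type*} (A : Matrix I K ℝ) (B : Matrix J K ℝ) : Matrix (I × J) K ℝ :=
  Matrix.of fun p c => A p.1 c * B p.2 c

/-- The order-2 tensor random projection `x ↦ k^{-1/2} (A ⊙ B)ᵀ x` from `ℝ^{d₁ d₂}` to `ℝ^k`. -/
def trp {d₁ d₂ k : ℕ} (A : Matrix (Fin d₁) (Fin k) ℝ) (B : Matrix (Fin d₂) (Fin k) ℝ)
    (x : EuclideanSpace ℝ (Fin d₁ × Fin d₂)) : EuclideanSpace ℝ (Fin k) :=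
  WithLp.toLp 2 ((1 / √(k : ℝ)) • ((khatriRao A B)ᵀ *ᵥ x.ofLp))

/-- The variance-reduced map TRP(T): the average, scaled by `T^{-1/2}`, of `T` replicates. -/
def trpReplicates {T d₁ d₂ k : ℕ} (A : Fin T → Matrix (Fin d₁) (Fin k) ℝ)
    (B : Fin T → Matrix (Fin d₂) (Fin k) ℝ)
    (x : EuclideanSpace ℝ (Fin d₁ × Fin d₂)) : EuclideanSpace ℝ (Fin k) :=
  (1 / √(T : ℝ)) • ∑ t, trp (A t) (B t) x

/-- With one replicate, TRP(T) is the TRP. -/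
theorem trpReplicates_one {d₁ d₂ k : ℕ} (A : Fin 1 → Matrix (Fin d₁) (Fin k) ℝ)
    (B : Fin 1 → Matrix (Fin d₂) (Fin k) ℝ) (x : EuclideanSpace ℝ (Fin d₁ × Fin d₂)) :
    trpReplicates A B x = trp (A 0) (B 0) x := by
  simp [trpReplicates]

/-- All entries of all factor matrices of all replicates, as one family of random variables. -/
def factorEntries {Ω : Type*} {T d₁ d₂ k : ℕ} (A : Fin T → Ω → Matrix (Fin d₁) (Fin k) ℝ)
    (B : Fin T → Ω → Matrix (Fin d₂) (Fin k) ℝ) :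
    Fin T × ((Fin d₁ × Fin k) ⊕ (Fin d₂ × Fin k)) → Ω → ℝ
  | (t, Sum.inl (a, i)), ω => A t ω a i
  | (t, Sum.inr (b, i)), ω => B t ω b i

end

/-! After dividing by `‖x‖`, the relative error is `k⁻¹ (∑ Yᵢ² - k)`, where `Y₁, …, Y_k` are
independent normalized sums of `T` independent bilinear forms `∑ c_ab A_a B_b` with `∑ c_ab² = 1`.
Such a form is centred with variance one. Given one factor it is a sub-Gaussian linear form in the
other, and its random variance proxy is a quadratic form in the first factor with a small
exponential moment; so it has an exponential moment at a scale of order `φ⁻²`, free of dimension.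
Normalized sums keep this moment uniformly in `T`, since `T` centred factors each contribute
`O(1/T)` to the log-mgf.

Squares of such variables have only stretched exponential tails, so Chernoff is applied after
truncation. With `m = k^(1/4)` and `r = (√k ε)^(1/2)`, the deviation `kε` equals `m² r²`, and
squares are cut at `(m r)²`. The tilt `l / (m² r)` then yields `exp (-l r)` with a bounded
second-order factor, and a union bound over `|Yᵢ| ≥ m r` costs no more, provided that `l` is at most
a constant times `m / φ²` (`measureReal_abs_sum_sq_sub_ge_le`).

This condition on `l` produces the two bounds: `l` of order `φ⁻²` is always admissible, while a
universal `l` requires `k^(1/4) ≥ φ²`. Otherwise `ε ≤ 1` forces `r < φ²`, and the bound is trivial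
for `C ≥ exp (φ²)`. -/

theorem exp_mul_le_one_add_add_sq {ρ : ℝ} (hρ : |ρ| ≤ 1) (u : ℝ) :
    Real.exp (ρ * u) ≤ 1 + ρ * u + 2 * ρ ^ 2 * Real.exp (2 * |u|) := by
  have h := Complex.norm_exp_sub_sum_le_norm_mul_exp ((ρ * u : ℝ) : ℂ) 2
  have h' : |Real.exp (ρ * u) - (1 + ρ * u)| ≤ |ρ * u| ^ 2 * Real.exp |ρ * u| := by
    have e : Complex.exp ((ρ * u : ℝ) : ℂ)
        - ∑ m ∈ Finset.range 2, ((ρ * u : ℝ) : ℂ) ^ m / (m.factorial : ℂ)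
        = ((Real.exp (ρ * u) - (1 + ρ * u) : ℝ) : ℂ) := by
      simp [Finset.sum_range_succ]
    rwa [e, Complex.norm_real, Complex.norm_real, Real.norm_eq_abs, Real.norm_eq_abs] at h
  have h1 := (abs_le.1 h').2
  have h2 : |ρ * u| ≤ |u| := by
    rw [abs_mul]; exact mul_le_of_le_one_left (abs_nonneg u) hρ
  -- The square in the Taylor remainder is absorbed into a second factor `exp |u|`, so that `ρ²`
  -- stays in front.
  have h3 : |u| ^ 2 ≤ 2 * Real.exp |u| := by
    have := Real.pow_div_factorial_le_exp |u| (abs_nonneg u) 2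
    norm_num [Nat.factorial] at this ⊢; linarith
  have h4 : |ρ * u| ^ 2 * Real.exp |ρ * u| ≤ 2 * ρ ^ 2 * Real.exp (2 * |u|) := by
    calc |ρ * u| ^ 2 * Real.exp |ρ * u| ≤ ρ ^ 2 * |u| ^ 2 * Real.exp |u| := by
          rw [abs_mul, mul_pow, sq_abs ρ, ← abs_mul]; gcongr
      _ ≤ ρ ^ 2 * (2 * Real.exp |u|) * Real.exp |u| := by gcongr
      _ = _ := by rw [two_mul |u|, Real.exp_add]; ring
  linarith

/-! ### Sub-Gaussian norm, moment generating functions and Gaussian linearization -/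

section

variable {Ω : Type*} {mΩ : MeasurableSpace Ω} {μ : Measure Ω}

/-- A bound on the lower Lebesgue integral of a nonnegative function gives integrability and the
same bound on the Bochner integral. -/
theorem integrable_and_integral_le_of_lintegral_le {f : Ω → ℝ} (hf : AEMeasurable f μ)
    (h0 : ∀ ω, 0 ≤ f ω) {K : ℝ} (hK : 0 ≤ K)
    (h : ∫⁻ ω, ENNReal.ofReal (f ω) ∂μ ≤ ENNReal.ofReal K) :
    Integrable f μ ∧ ∫ ω, f ω ∂μ ≤ K := by
  refine ⟨⟨hf.aestronglyMeasurable, ?_⟩, ?_⟩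
  · rw [hasFiniteIntegral_iff_ofReal (ae_of_all _ h0)]
    exact h.trans_lt ENNReal.ofReal_lt_top
  · rw [integral_eq_lintegral_of_nonneg_ae (ae_of_all _ h0) hf.aestronglyMeasurable]
    exact ENNReal.toReal_le_of_le_ofReal hK h

theorem lintegral_pow_le_of_subGaussianNorm_le {X : Ω → ℝ} {φ : ℝ} (hφ : 0 ≤ φ)
    (h : subGaussianNorm X μ ≤ ENNReal.ofReal φ) {n : ℕ} (hn : 1 ≤ n) :
    ∫⁻ ω, ENNReal.ofReal ((X ω ^ 2) ^ n) ∂μ ≤ ENNReal.ofReal ((2 * φ ^ 2 * n) ^ n) := by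
  have hn' : (1 : ℝ) ≤ n := by exact_mod_cast hn
  set p : ℝ := 2 * n with hp
  have hp0 : 0 < p := by positivity
  have h1 : ENNReal.ofReal (p ^ (-(1 / 2) : ℝ)) * eLpNorm X (ENNReal.ofReal p) μ
      ≤ ENNReal.ofReal φ :=
    (le_iSup₂ (f := fun (p : ℝ) (_ : 1 ≤ p) =>
      ENNReal.ofReal (p ^ (-(1 / 2) : ℝ)) * eLpNorm X (ENNReal.ofReal p) μ) p
      (by linarith)).trans h
  have h2 : eLpNorm X (ENNReal.ofReal p) μ ≤ ENNReal.ofReal (φ * p ^ (1 / 2 : ℝ)) := by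
    have e : ENNReal.ofReal (p ^ (1 / 2 : ℝ)) * ENNReal.ofReal (p ^ (-(1 / 2) : ℝ)) = 1 := by
      rw [← ENNReal.ofReal_mul (by positivity), ← Real.rpow_add hp0]; norm_num
    calc eLpNorm X (ENNReal.ofReal p) μ
        = ENNReal.ofReal (p ^ (1 / 2 : ℝ)) *
          (ENNReal.ofReal (p ^ (-(1 / 2) : ℝ)) * eLpNorm X (ENNReal.ofReal p) μ) := by
          rw [← mul_assoc, e, one_mul]
      _ ≤ ENNReal.ofReal (p ^ (1 / 2 : ℝ)) * ENNReal.ofReal φ := by gcongr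
      _ = _ := by rw [← ENNReal.ofReal_mul (by positivity), mul_comm]
  have h3 : ∫⁻ ω, ENNReal.ofReal ((X ω ^ 2) ^ n) ∂μ = eLpNorm X (ENNReal.ofReal p) μ ^ p := by
    rw [eLpNorm_eq_lintegral_rpow_enorm_toReal (by simpa using hp0) (by simp),
      ENNReal.toReal_ofReal hp0.le, ← ENNReal.rpow_mul, one_div, inv_mul_cancel₀ hp0.ne',
      ENNReal.rpow_one]
    refine lintegral_congr fun ω => ?_
    rw [← ofReal_norm, ENNReal.ofReal_rpow_of_nonneg (norm_nonneg _) hp0.le, hp,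
      Real.rpow_mul (norm_nonneg _), Real.rpow_natCast]
    norm_num
  rw [h3]
  calc eLpNorm X (ENNReal.ofReal p) μ ^ p ≤ ENNReal.ofReal (φ * p ^ (1 / 2 : ℝ)) ^ p := by gcongr
    _ = _ := by
      rw [ENNReal.ofReal_rpow_of_nonneg (by positivity) hp0.le, Real.mul_rpow hφ (by positivity),
        ← Real.rpow_mul hp0.le, show (1 / 2 : ℝ) * p = n by rw [hp]; ring, Real.rpow_natCast]
      congr 1
      rw [show φ ^ p = (φ ^ 2) ^ n by
        rw [hp, Real.rpow_mul hφ, Real.rpow_natCast]; norm_num, ← mul_pow, hp]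
      ring

/-- In the power series of the exponential, the moment bound and `nⁿ / n! ≤ eⁿ ≤ 3ⁿ` make the `n`-th
term at most `(2 · 3 / 12)ⁿ = 2⁻ⁿ`. -/
theorem lintegral_exp_sq_le_of_subGaussianNorm_le [IsProbabilityMeasure μ] {X : Ω → ℝ}
    (hX : AEMeasurable X μ) {φ : ℝ} (hφ : 0 < φ)
    (h : subGaussianNorm X μ ≤ ENNReal.ofReal φ) :
    ∫⁻ ω, ENNReal.ofReal (Real.exp (X ω ^ 2 / (12 * φ ^ 2))) ∂μ ≤ ENNReal.ofReal 2 := by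
  have key : ∀ n : ℕ, ∫⁻ ω, ENNReal.ofReal ((X ω ^ 2 / (12 * φ ^ 2)) ^ n / n.factorial) ∂μ
      ≤ ENNReal.ofReal ((1 / 2 : ℝ) ^ n) := by
    intro n
    rcases Nat.eq_zero_or_pos n with rfl | hn
    · simp
    have e : ∀ ω, ENNReal.ofReal ((X ω ^ 2 / (12 * φ ^ 2)) ^ n / n.factorial)
        = ENNReal.ofReal ((12 * φ ^ 2)⁻¹ ^ n / n.factorial) * ENNReal.ofReal ((X ω ^ 2) ^ n) := by
      intro ω
      rw [← ENNReal.ofReal_mul (by positivity), div_eq_mul_inv (X ω ^ 2), mul_pow]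
      ring_nf
    simp_rw [e]
    rw [lintegral_const_mul' _ _ ENNReal.ofReal_ne_top]
    refine (mul_le_mul_right (lintegral_pow_le_of_subGaussianNorm_le hφ.le h hn) _).trans ?_
    rw [← ENNReal.ofReal_mul (by positivity)]
    refine ENNReal.ofReal_le_ofReal ?_
    have h1 : (n : ℝ) ^ n / n.factorial ≤ 3 ^ n := by
      refine (Real.pow_div_factorial_le_exp (n : ℝ) (by positivity) n).trans ?_
      rw [← mul_one (n : ℝ), Real.exp_nat_mul]
      gcongr
      exact (Real.exp_one_lt_d9.trans (by norm_num)).le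
    calc (12 * φ ^ 2)⁻¹ ^ n / n.factorial * (2 * φ ^ 2 * n) ^ n
        = (1 / 6) ^ n * ((n : ℝ) ^ n / n.factorial) := by
          rw [show (1 / 6 : ℝ) = (12 * φ ^ 2)⁻¹ * (2 * φ ^ 2) by field_simp; norm_num,
            mul_pow (12 * φ ^ 2)⁻¹, mul_pow (2 * φ ^ 2) (n : ℝ)]
          ring
      _ ≤ (1 / 6) ^ n * 3 ^ n := by gcongr
      _ = (1 / 2) ^ n := by rw [← mul_pow]; norm_num
  have hs : ∀ ω, ENNReal.ofReal (Real.exp (X ω ^ 2 / (12 * φ ^ 2)))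
      = ∑' n : ℕ, ENNReal.ofReal ((X ω ^ 2 / (12 * φ ^ 2)) ^ n / n.factorial) := by
    intro ω
    rw [Real.exp_eq_exp_ℝ, NormedSpace.exp_eq_tsum_div,
      ENNReal.ofReal_tsum_of_nonneg (fun n => by positivity)
        (NormedSpace.expSeries_div_summable (𝔸 := ℝ) _)]
  simp_rw [hs]
  rw [lintegral_tsum fun n => by fun_prop]
  refine (ENNReal.tsum_le_tsum key).trans ?_
  rw [← ENNReal.ofReal_tsum_of_nonneg (fun n => by positivity) summable_geometric_two,
    tsum_geometric_two]

/-- A centred random variable with finite sub-Gaussian norm has a sub-Gaussian moment generating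
function. -/
theorem hasSubgaussianMGF_of_subGaussianNorm_le [IsProbabilityMeasure μ] {X : Ω → ℝ}
    (hX : AEMeasurable X μ) (hint : Integrable X μ) (h0 : ∫ ω, X ω ∂μ = 0) {φ : ℝ} (hφ : 0 < φ)
    (h : subGaussianNorm X μ ≤ ENNReal.ofReal φ) :
    HasSubgaussianMGF X (Real.toNNReal (288 * φ ^ 2)) μ := by
  obtain ⟨hi, hle⟩ := integrable_and_integral_le_of_lintegral_le
    (f := fun ω => Real.exp (X ω ^ 2 / (12 * φ ^ 2))) (by fun_prop) (fun ω => (Real.exp_pos _).le)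
    zero_le_two (lintegral_exp_sq_le_of_subGaussianNorm_le hX hφ h)
  set r : ℝ := √(12 * φ ^ 2) with hr
  have hr0 : 0 < r := by positivity
  have hr2 : r ^ 2 = 12 * φ ^ 2 := Real.sq_sqrt (by positivity)
  have hu : ∀ ω, X ω ^ 2 / (12 * φ ^ 2) = (X ω / r) ^ 2 := fun ω => by rw [div_pow, hr2]
  simp_rw [hu] at hi hle
  have hbig : ∀ t ω, Real.exp (t * X ω) ≤
      Real.exp ((t * r) ^ 2 / 2) * Real.exp ((X ω / r) ^ 2) := by
    intro t ω
    rw [← Real.exp_add, Real.exp_le_exp]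
    have : t * X ω = (t * r) * (X ω / r) := by field_simp
    rw [this]
    nlinarith [sq_nonneg (t * r - X ω / r), sq_nonneg (X ω / r)]
  have hI : ∀ t, Integrable (fun ω => Real.exp (t * X ω)) μ := fun t =>
    (hi.const_mul _).mono' (by fun_prop) (ae_of_all _ fun ω => by
      rw [Real.norm_of_nonneg (Real.exp_pos _).le]; exact hbig t ω)
  refine ⟨hI, fun t => ?_⟩
  have hc : ((Real.toNNReal (288 * φ ^ 2) : NNReal) : ℝ) * t ^ 2 / 2 = 12 * (t * r) ^ 2 := by
    rw [Real.coe_toNNReal _ (by positivity), mul_pow, hr2]; ring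
  rw [hc, mgf]
  -- For small `t` the zero mean removes the linear term. For large `t` centring is not needed: the
  -- factor `2` is absorbed by `exp ((t r)²)`.
  rcases le_or_gt |t * r| 1 with hρ | hρ
  · have hb : ∀ ω, Real.exp (t * X ω) ≤ 1 + t * X ω
        + 2 * (t * r) ^ 2 * (3 * Real.exp ((X ω / r) ^ 2)) := by
      intro ω
      have e : t * X ω = (t * r) * (X ω / r) := by field_simp
      rw [e]
      refine (exp_mul_le_one_add_add_sq hρ _).trans ?_
      gcongr
      calc Real.exp (2 * |X ω / r|) ≤ Real.exp (1 + (X ω / r) ^ 2) := by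
            rw [Real.exp_le_exp, ← sq_abs]; nlinarith [sq_nonneg (|X ω / r| - 1)]
        _ ≤ _ := by
            rw [Real.exp_add]; gcongr; exact (Real.exp_one_lt_d9.trans (by norm_num)).le
    have hi1 : Integrable (fun ω => 1 + t * X ω) μ := (integrable_const _).add (hint.const_mul t)
    have hi2 : Integrable (fun ω => 2 * (t * r) ^ 2 * (3 * Real.exp ((X ω / r) ^ 2))) μ :=
      (hi.const_mul _).const_mul _
    calc ∫ ω, Real.exp (t * X ω) ∂μ ≤ ∫ ω, (1 + t * X ω
          + 2 * (t * r) ^ 2 * (3 * Real.exp ((X ω / r) ^ 2))) ∂μ :=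
          integral_mono (hI t) (hi1.add hi2) hb
      _ = 1 + 2 * (t * r) ^ 2 * (3 * ∫ ω, Real.exp ((X ω / r) ^ 2) ∂μ) := by
          rw [integral_add hi1 hi2, integral_add (integrable_const _) (hint.const_mul t),
            integral_const_mul, integral_const_mul, integral_const_mul, h0]
          simp
      _ ≤ 1 + 2 * (t * r) ^ 2 * (3 * 2) := by gcongr
      _ ≤ Real.exp (12 * (t * r) ^ 2) := by
          linarith [Real.add_one_le_exp (12 * (t * r) ^ 2)]
  · have hρ2 : 1 ≤ (t * r) ^ 2 := by rw [← sq_abs]; nlinarith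
    calc ∫ ω, Real.exp (t * X ω) ∂μ
        ≤ ∫ ω, Real.exp ((t * r) ^ 2 / 2) * Real.exp ((X ω / r) ^ 2) ∂μ :=
          integral_mono (hI t) (hi.const_mul _) (hbig t)
      _ ≤ Real.exp ((t * r) ^ 2 / 2) * 2 := by rw [integral_const_mul]; gcongr
      _ ≤ Real.exp ((t * r) ^ 2 / 2) * Real.exp ((t * r) ^ 2) := by
          gcongr; linarith [Real.add_one_le_exp ((t * r) ^ 2)]
      _ ≤ Real.exp (12 * (t * r) ^ 2) := by
          rw [← Real.exp_add, Real.exp_le_exp]; nlinarith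

/-- The exponential moment of the square of a sub-Gaussian random variable, by integrating the
moment generating function against a Gaussian. -/
theorem ProbabilityTheory.HasSubgaussianMGF.lintegral_exp_sq_le [IsProbabilityMeasure μ] {X : Ω → ℝ} {c v : NNReal}
    (hX : HasSubgaussianMGF X c μ) (hv : v ≠ 0) (hcv : 2 * c * v ≤ 1) :
    ∫⁻ ω, ENNReal.ofReal (Real.exp (v * X ω ^ 2 / 2)) ∂μ ≤ ENNReal.ofReal √2 := by
  have hv0 : (0 : ℝ) < v := by positivity
  have hXm : AEMeasurable X μ := hX.aemeasurable
  have h1 : ∀ ω, ENNReal.ofReal (Real.exp (v * X ω ^ 2 / 2))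
      = ∫⁻ t, ENNReal.ofReal (Real.exp (X ω * t)) ∂(gaussianReal 0 v) := by
    intro ω
    rw [← ofReal_integral_eq_lintegral_ofReal (integrable_exp_mul_gaussianReal _)
      (ae_of_all _ fun t => (Real.exp_pos _).le)]
    have := mgf_gaussianReal (p := gaussianReal 0 v) (X := id) (μ := 0) (v := v) (by simp) (X ω)
    simp only [mgf, id] at this
    rw [this]; simp
  simp_rw [h1]
  have hm : AEMeasurable (Function.uncurry fun ω t => ENNReal.ofReal (Real.exp (X ω * t)))
      (μ.prod (gaussianReal 0 v)) := by
    have : AEMeasurable (fun p : Ω × ℝ => X p.1) (μ.prod (gaussianReal 0 v)) :=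
      hXm.comp_fst
    simp only [Function.uncurry_def]
    fun_prop
  rw [lintegral_lintegral_swap hm]
  -- Since `c ≤ 1 / (2v)`, half of the Gaussian exponent `t² / (2v)` survives; the variance doubles,
  -- which accounts for the value `√2`.
  have h2 : ∀ t, ∫⁻ ω, ENNReal.ofReal (Real.exp (X ω * t)) ∂μ
      ≤ ENNReal.ofReal (Real.exp (t ^ 2 / (4 * v))) := by
    intro t
    simp_rw [mul_comm _ t]
    rw [← ofReal_integral_eq_lintegral_ofReal (hX.integrable_exp_mul t)
      (ae_of_all _ fun t => (Real.exp_pos _).le)]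
    refine ENNReal.ofReal_le_ofReal ((hX.mgf_le t).trans (Real.exp_le_exp.2 ?_))
    have hcv' : 2 * (c : ℝ) * v ≤ 1 := by exact_mod_cast hcv
    rw [le_div_iff₀ (by positivity)]
    nlinarith [sq_nonneg t]
  refine (lintegral_mono h2).trans ?_
  rw [gaussianReal_of_var_ne_zero _ hv, lintegral_withDensity_eq_lintegral_mul _
    (measurable_gaussianPDF _ _) (by fun_prop)]
  have h3 : ∀ t, (gaussianPDF 0 v * fun t => ENNReal.ofReal (Real.exp (t ^ 2 / (4 * v)))) t
      = ENNReal.ofReal ((√(2 * Real.pi * v))⁻¹ * Real.exp (-(4 * v : ℝ)⁻¹ * t ^ 2)) := by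
    intro t
    rw [Pi.mul_apply, gaussianPDF, ← ENNReal.ofReal_mul (gaussianPDFReal_nonneg _ _ _),
      gaussianPDFReal, mul_assoc, ← Real.exp_add]
    congr 3
    field_simp
    ring
  simp_rw [h3]
  rw [← ofReal_integral_eq_lintegral_ofReal
    ((integrable_exp_neg_mul_sq (by positivity)).const_mul _)
    (ae_of_all _ fun t => by positivity), integral_const_mul, integral_gaussian]
  refine ENNReal.ofReal_le_ofReal (le_of_eq ?_)
  rw [← Real.sqrt_inv, ← Real.sqrt_mul (by positivity)]
  congr 1
  field_simp
  norm_num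

/-- Mean and second moment of a linear combination of uncorrelated standardized variables. -/
theorem integral_and_integral_sq_sum_of_indep [IsProbabilityMeasure μ] {ι : Type*} [Fintype ι]
    {X : ι → Ω → ℝ} (hX : iIndepFun X μ) (hL : ∀ i, MemLp (X i) 2 μ) (h0 : ∀ i, ∫ ω, X i ω ∂μ = 0)
    (h1 : ∀ i, ∫ ω, X i ω ^ 2 ∂μ = 1) (w : ι → ℝ) :
    ∫ ω, ∑ i, w i * X i ω ∂μ = 0 ∧ ∫ ω, (∑ i, w i * X i ω) ^ 2 ∂μ = ∑ i, w i ^ 2 := by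
  have hm : ∫ ω, ∑ i, w i * X i ω ∂μ = 0 := by
    rw [integral_finsetSum _ fun i _ => ((hL i).integrable (by norm_num)).const_mul _]
    simp [integral_const_mul, h0]
  refine ⟨hm, ?_⟩
  have hL' : ∀ i, MemLp (fun ω => w i * X i ω) 2 μ := fun i => (hL i).const_mul _
  have hind : iIndepFun (fun i ω => w i * X i ω) μ :=
    hX.comp (fun i x => w i * x) fun i => by fun_prop
  have hv := IndepFun.variance_sum (μ := μ) (s := Finset.univ) (fun i _ => hL' i)
    fun i _ j _ hij => hind.indepFun hij
  have e : (∑ i, fun ω => w i * X i ω) = fun ω => ∑ i, w i * X i ω := by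
    ext ω; simp
  rw [e, variance_of_integral_eq_zero (memLp_finsetSum _ fun i _ => hL' i).aemeasurable hm] at hv
  rw [hv]
  refine Finset.sum_congr rfl fun i _ => ?_
  rw [variance_of_integral_eq_zero (hL' i).aemeasurable (by rw [integral_const_mul, h0, mul_zero])]
  simp_rw [mul_pow]
  rw [integral_const_mul, h1, mul_one]

end

/-! ### Exponential moments of bilinear forms -/

section

variable {I J : Type*} [Fintype I] [Fintype J] {ν : Measure ℝ} [IsProbabilityMeasure ν]

theorem hasSubgaussianMGF_sum_mul_pi {s : ℝ}
    (hν : HasSubgaussianMGF id s.toNNReal ν) (w : I → ℝ) :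
    HasSubgaussianMGF (fun a : I → ℝ => ∑ i, w i * a i) (Real.toNNReal (s * ∑ i, w i ^ 2))
      (Measure.pi fun _ => ν) := by
  have hind : iIndepFun (fun (i : I) (a : I → ℝ) => w i * a i) (Measure.pi fun _ => ν) :=
    iIndepFun_pi (μ := fun _ : I => ν) (X := fun i x => w i * x) fun i => by fun_prop
  have h : ∀ i : I, HasSubgaussianMGF (fun a : I → ℝ => w i * a i)
      ((w i ^ 2).toNNReal * s.toNNReal) (Measure.pi fun _ => ν) := fun i => by
    have hid : HasSubgaussianMGF (fun a : I → ℝ => a i) s.toNNReal (Measure.pi fun _ => ν) := by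
      rw [← HasSubgaussianMGF.id_map_iff (measurable_pi_apply i).aemeasurable]
      rwa [show (fun a : I → ℝ => a i) = Function.eval i from rfl,
        (measurePreserving_eval (fun _ : I => ν) i).map_eq]
    rw [Real.toNNReal_of_nonneg (sq_nonneg (w i))]
    exact hid.const_mul (w i)
  convert HasSubgaussianMGF.sum_of_iIndepFun hind (s := Finset.univ) fun i _ => h i using 1
  rw [← Finset.sum_mul, ← Real.toNNReal_sum_of_nonneg fun i _ => sq_nonneg (w i),
    ← Real.toNNReal_mul (Finset.sum_nonneg fun i _ => sq_nonneg (w i)), mul_comm]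

theorem integral_sum_mul_pi (hL : MemLp id 2 ν) (h0 : ∫ y, y ∂ν = 0) (h1 : ∫ y, y ^ 2 ∂ν = 1)
    (w : I → ℝ) :
    ∫ a : I → ℝ, ∑ i, w i * a i ∂(Measure.pi fun _ => ν) = 0 ∧
      ∫ a : I → ℝ, (∑ i, w i * a i) ^ 2 ∂(Measure.pi fun _ => ν) = ∑ i, w i ^ 2 := by
  refine integral_and_integral_sq_sum_of_indep (μ := Measure.pi fun _ : I => ν)
    (X := fun i a => a i) (iIndepFun_pi (X := fun _ x => x) fun i => by fun_prop)
    (fun i => hL.comp_measurePreserving (measurePreserving_eval (fun _ : I => ν) i))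
    (fun i => ?_) (fun i => ?_) w
  · rw [integral_comp_eval (μ := fun _ : I => ν) (f := fun y => y) (by fun_prop), h0]
  · rw [integral_comp_eval (μ := fun _ : I => ν) (f := fun y => y ^ 2) (by fun_prop), h1]

/-- The bilinear form with coefficients `c` in a pair of vectors. -/
def bilinearChaos (c : I → J → ℝ) (p : (I → ℝ) × (J → ℝ)) : ℝ :=
  ∑ j, (∑ i, c i j * p.1 i) * p.2 j

theorem measurable_bilinearChaos (c : I → J → ℝ) : Measurable (bilinearChaos c) := by
  unfold bilinearChaos; fun_prop

/-- The column weights `p j = ∑ i, c i j ^ 2` sum to one, so the sum of squares is a convex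
combination of squares of normalized linear forms. Jensen's inequality for `exp` reduces to a single
form; no independence between columns is needed. -/
theorem lintegral_exp_sum_sq_le {s : ℝ} (hs : 0 < s) (hν : HasSubgaussianMGF id s.toNNReal ν)
    {c : I → J → ℝ} (hc : ∑ i, ∑ j, c i j ^ 2 = 1) {v : ℝ} (hv : 0 < v) (hsv : 2 * s * v ≤ 1) :
    ∫⁻ a : I → ℝ, ENNReal.ofReal (Real.exp (v * (∑ j, (∑ i, c i j * a i) ^ 2) / 2))
      ∂(Measure.pi fun _ => ν) ≤ ENNReal.ofReal √2 := by
  set p : J → ℝ := fun j => ∑ i, c i j ^ 2 with hp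
  have hp0 : ∀ j, 0 ≤ p j := fun j => Finset.sum_nonneg fun i _ => sq_nonneg _
  have hp1 : ∑ j, p j = 1 := by rw [← hc, Finset.sum_comm]
  set z : J → (I → ℝ) → ℝ := fun j a => ∑ i, (c i j / √(p j)) * a i with hz
  have hz' : ∀ j a, p j * z j a ^ 2 = (∑ i, c i j * a i) ^ 2 := by
    intro j a
    rcases (hp0 j).eq_or_lt with h | h
    · have : ∀ i, c i j = 0 := fun i => by
        have := (Finset.sum_eq_zero_iff_of_nonneg (fun i _ => sq_nonneg (c i j))).1 h.symm i
          (Finset.mem_univ _)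
        simpa using this
      simp [← h, this]
    · have e : z j a = (∑ i, c i j * a i) / √(p j) := by
        rw [hz, Finset.sum_div]; exact Finset.sum_congr rfl fun i _ => by ring
      rw [e, div_pow, Real.sq_sqrt h.le]; field_simp
  have hpt : ∀ a, ENNReal.ofReal (Real.exp (v * (∑ j, (∑ i, c i j * a i) ^ 2) / 2))
      ≤ ∑ j, ENNReal.ofReal (p j) * ENNReal.ofReal (Real.exp (v * z j a ^ 2 / 2)) := by
    intro a
    have e : v * (∑ j, (∑ i, c i j * a i) ^ 2) / 2 = ∑ j, p j • (v * z j a ^ 2 / 2) := by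
      simp_rw [← hz', Finset.mul_sum, Finset.sum_div, smul_eq_mul]
      exact Finset.sum_congr rfl fun j _ => by ring
    have hj := convexOn_exp.map_sum_le (t := Finset.univ) (w := p)
      (p := fun j => v * z j a ^ 2 / 2) (fun j _ => hp0 j) hp1 (fun j _ => Set.mem_univ _)
    rw [e]
    refine (ENNReal.ofReal_le_ofReal hj).trans (le_of_eq ?_)
    rw [ENNReal.ofReal_sum_of_nonneg fun j _ => by have := hp0 j; positivity]
    exact Finset.sum_congr rfl fun j _ => by rw [smul_eq_mul, ENNReal.ofReal_mul (hp0 j)]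
  have hzb : ∀ j, ∫⁻ a, ENNReal.ofReal (Real.exp (v * z j a ^ 2 / 2)) ∂(Measure.pi fun _ => ν)
      ≤ ENNReal.ofReal √2 := by
    intro j
    have hsub := hasSubgaussianMGF_sum_mul_pi hν fun i => c i j / √(p j)
    -- The sum is `p j / p j`, which is `0` and not `1` for a vanishing column.
    have hle : ∑ i, (c i j / √(p j)) ^ 2 ≤ 1 := by
      simp_rw [div_pow, Real.sq_sqrt (hp0 j)]
      rw [← Finset.sum_div]; exact div_self_le_one _
    have := hsub.lintegral_exp_sq_le (v := v.toNNReal) (by simpa using hv) (by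
      rw [← NNReal.coe_le_coe]
      push_cast
      rw [Real.coe_toNNReal _ (by positivity), Real.coe_toNNReal _ hv.le]
      calc 2 * (s * ∑ i, (c i j / √(p j)) ^ 2) * v ≤ 2 * (s * 1) * v := by gcongr
        _ ≤ 1 := by linarith)
    rwa [Real.coe_toNNReal _ hv.le] at this
  refine (lintegral_mono hpt).trans ?_
  rw [lintegral_finsetSum _ fun j _ => by fun_prop]
  calc ∑ j, ∫⁻ a, ENNReal.ofReal (p j) * ENNReal.ofReal (Real.exp (v * z j a ^ 2 / 2))
        ∂(Measure.pi fun _ => ν)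
      ≤ ∑ j, ENNReal.ofReal (p j) * ENNReal.ofReal √2 := by
        refine Finset.sum_le_sum fun j _ => ?_
        rw [lintegral_const_mul' _ _ ENNReal.ofReal_ne_top]
        gcongr; exact hzb j
    _ = ENNReal.ofReal √2 := by
        rw [← Finset.sum_mul, ← ENNReal.ofReal_sum_of_nonneg fun j _ => hp0 j, hp1]; simp

/-- Integrating out the second vector first leaves `exp (s θ² S / 2)`, with `S` the sum of squared
linear forms in the first; `lintegral_exp_sum_sq_le` applies with `v = s θ²`. -/
theorem lintegral_exp_bilinearChaos_le {s : ℝ} (hs : 0 < s)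
    (hν : HasSubgaussianMGF id s.toNNReal ν) {c : I → J → ℝ} (hc : ∑ i, ∑ j, c i j ^ 2 = 1)
    {θ : ℝ} (h0 : θ ≠ 0) (hθ : 2 * (s * θ) ^ 2 ≤ 1) :
    ∫⁻ p, ENNReal.ofReal (Real.exp (θ * bilinearChaos c p))
      ∂((Measure.pi fun _ => ν).prod (Measure.pi fun _ => ν)) ≤ ENNReal.ofReal √2 := by
  have := measurable_bilinearChaos c
  rw [lintegral_prod _ (by fun_prop)]
  refine (lintegral_mono fun a => ?_).trans (lintegral_exp_sum_sq_le hs hν hc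
    (v := s * θ ^ 2) (by positivity) (by linarith))
  have hsub := hasSubgaussianMGF_sum_mul_pi hν fun j => ∑ i, c i j * a i
  have hm := hsub.mgf_le θ
  rw [mgf, Real.coe_toNNReal _ (by positivity)] at hm
  simp only [bilinearChaos]
  rw [← ofReal_integral_eq_lintegral_ofReal (hsub.integrable_exp_mul θ)
      (ae_of_all _ fun t => (Real.exp_pos _).le)]
  refine ENNReal.ofReal_le_ofReal (hm.trans (le_of_eq ?_))
  congr 1; ring

/-- A random variable is standardized with exponential moment at `θ` at most `K`. -/
structure IsStandardSubexp {Ω : Type*} [MeasurableSpace Ω] (Z : Ω → ℝ) (θ K : ℝ)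
    (μ : Measure Ω) : Prop where
  integrable_exp : Integrable (fun ω => Real.exp (θ * |Z ω|)) μ
  integral_exp_le : ∫ ω, Real.exp (θ * |Z ω|) ∂μ ≤ K
  integral_eq_zero : ∫ ω, Z ω ∂μ = 0
  integral_sq : ∫ ω, Z ω ^ 2 ∂μ = 1

theorem pow_four_mul_exp_le {θ : ℝ} (hθ : 0 < θ) {y : ℝ} (hy : 0 ≤ y) :
    y ^ 4 ≤ 24 / θ ^ 4 * Real.exp (θ * y) := by
  have := Real.pow_div_factorial_le_exp (θ * y) (by positivity) 4
  rw [show ((Nat.factorial 4 : ℕ) : ℝ) = 24 by norm_num [Nat.factorial], mul_pow,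
    div_le_iff₀ (by norm_num)] at this
  rw [div_mul_eq_mul_div, le_div_iff₀ (by positivity)]
  linarith

theorem memLp_two_of_integrable_exp {Ω : Type*} [MeasurableSpace Ω] {μ : Measure Ω} {Z : Ω → ℝ}
    {θ : ℝ} (hθ : 0 < θ) (hZ : AEMeasurable Z μ)
    (h : Integrable (fun ω => Real.exp (θ * |Z ω|)) μ) : MemLp Z 2 μ := by
  rw [memLp_two_iff_integrable_sq hZ.aestronglyMeasurable]
  refine (h.const_mul (2 / θ ^ 2)).mono' (by fun_prop) (ae_of_all _ fun ω => ?_)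
  have := Real.pow_div_factorial_le_exp (θ * |Z ω|) (by positivity) 2
  rw [show ((Nat.factorial 2 : ℕ) : ℝ) = 2 by norm_num [Nat.factorial], mul_pow, sq_abs,
    div_le_iff₀ (by norm_num)] at this
  rw [Real.norm_of_nonneg (sq_nonneg _), div_mul_eq_mul_div, le_div_iff₀ (by positivity)]
  linarith

theorem exp_mul_abs_le {θ : ℝ} (y : ℝ) :
    Real.exp (θ * |y|) ≤ Real.exp (θ * y) + Real.exp (-θ * y) := by
  rcases abs_cases y with ⟨h, -⟩ | ⟨h, -⟩ <;> rw [h]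
  · linarith [Real.exp_pos (-θ * y)]
  · rw [mul_neg, neg_mul]; linarith [Real.exp_pos (θ * y)]

/-- At `θ = ±1 / (2s)` the condition reads `2 · (1/4) ≤ 1`, and the two signs together give `2√2 ≤
3`. Mean and variance follow by Fubini. -/
theorem isStandardSubexp_bilinearChaos {s : ℝ} (hs : 0 < s)
    (hν : HasSubgaussianMGF id s.toNNReal ν) (hν0 : ∫ y, y ∂ν = 0) (hν1 : ∫ y, y ^ 2 ∂ν = 1)
    {c : I → J → ℝ} (hc : ∑ i, ∑ j, c i j ^ 2 = 1) :
    IsStandardSubexp (bilinearChaos c) (1 / (2 * s)) 3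
      ((Measure.pi fun _ => ν).prod (Measure.pi fun _ => ν)) := by
  have hm := measurable_bilinearChaos c
  have hθ : 2 * (s * (1 / (2 * s))) ^ 2 ≤ 1 := by
    rw [show s * (1 / (2 * s)) = 1 / 2 by field_simp]; norm_num
  have hsq : √2 ≤ 3 / 2 := by rw [Real.sqrt_le_left (by norm_num)]; norm_num
  obtain ⟨hI, hle⟩ := integrable_and_integral_le_of_lintegral_le
    (μ := (Measure.pi fun _ : I => ν).prod (Measure.pi fun _ : J => ν))
    (f := fun p => Real.exp (1 / (2 * s) * |bilinearChaos c p|)) (by fun_prop)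
    (fun ω => (Real.exp_pos _).le) (by norm_num : (0 : ℝ) ≤ 3) (by
      calc _ ≤ ∫⁻ p, (ENNReal.ofReal (Real.exp (1 / (2 * s) * bilinearChaos c p))
              + ENNReal.ofReal (Real.exp (-(1 / (2 * s)) * bilinearChaos c p)))
              ∂((Measure.pi fun _ => ν).prod (Measure.pi fun _ => ν)) := by
            refine lintegral_mono fun p => ?_
            rw [← ENNReal.ofReal_add (by positivity) (by positivity)]
            exact ENNReal.ofReal_le_ofReal (exp_mul_abs_le _)
        _ ≤ ENNReal.ofReal √2 + ENNReal.ofReal √2 := by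
            rw [lintegral_add_left (by fun_prop)]
            gcongr
            · exact lintegral_exp_bilinearChaos_le hs hν hc (by positivity) hθ
            · refine lintegral_exp_bilinearChaos_le hs hν hc (by simp; positivity) ?_
              rw [mul_neg, neg_sq]; exact hθ
        _ ≤ ENNReal.ofReal 3 := by
            rw [← ENNReal.ofReal_add (by positivity) (by positivity)]
            exact ENNReal.ofReal_le_ofReal (by linarith))
  have hL := memLp_two_of_integrable_exp (by positivity) hm.aemeasurable hI
  have hLν : MemLp id 2 ν := hν.memLp 2
  refine ⟨hI, hle, ?_, ?_⟩
  · rw [integral_prod _ (hL.integrable (by norm_num))]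
    simp only [bilinearChaos, integral_sum_mul_pi hLν hν0 hν1, integral_zero]
  · rw [integral_prod _ hL.integrable_sq]
    simp only [bilinearChaos, integral_sum_mul_pi hLν hν0 hν1]
    rw [integral_finsetSum, ← hc, Finset.sum_comm]
    · exact Finset.sum_congr rfl fun j _ => (integral_sum_mul_pi hLν hν0 hν1 _).2
    · intro j _
      exact ((hasSubgaussianMGF_sum_mul_pi hν fun i => c i j).memLp 2).integrable_sq

end

/-! ### Grouping independent variables and summing replicates -/

section

variable {Ω : Type*} [MeasurableSpace Ω] {μ : Measure Ω}

theorem IsStandardSubexp.comp_hasLaw {E : Type*} [MeasurableSpace E] {Q : Measure E} {f : E → ℝ}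
    {θ K : ℝ} (hf : IsStandardSubexp f θ K Q) (hfm : Measurable f) {W : Ω → E}
    (hW : HasLaw W Q μ) : IsStandardSubexp (fun ω => f (W ω)) θ K μ := by
  refine ⟨?_, ?_, ?_, ?_⟩
  · have := hf.integrable_exp
    rw [← hW.map_eq] at this
    exact (integrable_map_measure (by fun_prop) hW.aemeasurable).1 this
  · have := hW.integral_comp (f := fun e => Real.exp (θ * |f e|)) (by fun_prop)
    exact this.le.trans hf.integral_exp_le
  · exact (hW.integral_comp (f := f) (by fun_prop)).trans hf.integral_eq_zero
  · exact (hW.integral_comp (f := fun e => f e ^ 2) (by fun_prop)).trans hf.integral_sq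

variable [IsProbabilityMeasure μ]

/-- Independence is the statement that the joint law is a product, and currying carries the product
over `ι × κ` to a product of products. It serves both to group entries into factor pairs and to
group replicates into coordinates. -/
theorem iIndepFun_curry {ι κ : Type*} [Fintype ι] [Fintype κ] {X : ι × κ → Ω → ℝ} {ν : Measure ℝ}
    [IsProbabilityMeasure ν] (h : iIndepFun X μ) (hX : ∀ p, HasLaw (X p) ν μ) :
    iIndepFun (fun i ω j => X (i, j) ω) μ := by
  have hrow : ∀ i, HasLaw (fun ω j => X (i, j) ω) (Measure.pi fun _ : κ => ν) μ := fun i =>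
    (h.precomp (g := fun j => (i, j)) (Prod.mk_right_injective i)).hasLaw_pi fun j => hX (i, j)
  rw [iIndepFun_iff_hasLaw_pi_pi hrow]
  have hall := h.hasLaw_pi hX
  have hc : MeasurePreserving (MeasurableEquiv.curry ι κ ℝ) (Measure.pi fun _ : ι × κ => ν)
      (Measure.pi fun _ : ι => Measure.pi fun _ : κ => ν) := by
    refine ⟨(MeasurableEquiv.curry ι κ ℝ).measurable, ?_⟩
    have := Measure.infinitePi_map_curry (ι := ι) (κ := κ) (X := ℝ) fun _ _ => ν
    simpa [Measure.infinitePi_eq_pi] using this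
  exact hc.fun_comp_hasLaw hall

theorem IsStandardSubexp.mgf_le {Z : Ω → ℝ} {θ K : ℝ} (hZ : IsStandardSubexp Z θ K μ)
    (hZm : AEMeasurable Z μ) (hθ : 0 < θ) {ρ : ℝ} (hρ : |ρ| ≤ 1) :
    Integrable (fun ω => Real.exp (ρ * (θ / 2) * Z ω)) μ ∧
      mgf Z μ (ρ * (θ / 2)) ≤ Real.exp (2 * ρ ^ 2 * K) := by
  have hint : Integrable Z μ :=
    (memLp_two_of_integrable_exp hθ hZm hZ.integrable_exp).integrable (by norm_num)
  have hb : ∀ ω, Real.exp (ρ * (θ / 2) * Z ω)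
      ≤ 1 + ρ * (θ / 2) * Z ω + 2 * ρ ^ 2 * Real.exp (θ * |Z ω|) := by
    intro ω
    have := exp_mul_le_one_add_add_sq hρ (θ / 2 * Z ω)
    rw [abs_mul, abs_of_pos (by positivity : 0 < θ / 2), ← mul_assoc,
      show 2 * (θ / 2 * |Z ω|) = θ * |Z ω| by ring] at this
    exact this
  have h1 : Integrable (fun ω => 1 + ρ * (θ / 2) * Z ω) μ :=
    (integrable_const _).add (hint.const_mul _)
  have h2 : Integrable (fun ω => 2 * ρ ^ 2 * Real.exp (θ * |Z ω|)) μ :=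
    hZ.integrable_exp.const_mul _
  have hI : Integrable (fun ω => Real.exp (ρ * (θ / 2) * Z ω)) μ :=
    (h1.add h2).mono' (by fun_prop) (ae_of_all _ fun ω => by
      rw [Real.norm_of_nonneg (Real.exp_pos _).le]; exact hb ω)
  refine ⟨hI, ?_⟩
  calc mgf Z μ (ρ * (θ / 2))
      ≤ ∫ ω, (1 + ρ * (θ / 2) * Z ω + 2 * ρ ^ 2 * Real.exp (θ * |Z ω|)) ∂μ :=
        integral_mono hI (h1.add h2) hb
    _ = 1 + 2 * ρ ^ 2 * ∫ ω, Real.exp (θ * |Z ω|) ∂μ := by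
        rw [integral_add h1 h2, integral_add (integrable_const _) (hint.const_mul _),
          integral_const_mul, integral_const_mul, hZ.integral_eq_zero]
        simp
    _ ≤ 1 + 2 * ρ ^ 2 * K := by gcongr; exact hZ.integral_exp_le
    _ ≤ Real.exp (2 * ρ ^ 2 * K) := by linarith [Real.add_one_le_exp (2 * ρ ^ 2 * K)]

/-- With `ρ = ±1/√T` each centred factor has mgf at most `exp (2K / T)`, so the product is at most
`exp (2K)` whatever `T`; the two signs bound the exponential of the absolute value. -/
theorem isStandardSubexp_normalized_sum {T : ℕ} (hT : 1 ≤ T) {Z : Fin T → Ω → ℝ} {θ K : ℝ}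
    (hθ : 0 < θ) (hind : iIndepFun Z μ) (hZm : ∀ t, AEMeasurable (Z t) μ)
    (hZ : ∀ t, IsStandardSubexp (Z t) θ K μ) :
    IsStandardSubexp (fun ω => (1 / √(T : ℝ)) * ∑ t, Z t ω) (θ / 2) (2 * Real.exp (2 * K)) μ := by
  have hT0 : (0 : ℝ) < T := by exact_mod_cast hT
  have hT1 : (1 : ℝ) ≤ T := by exact_mod_cast hT
  have hsT : √(T : ℝ) ^ 2 = T := Real.sq_sqrt hT0.le
  set Y : Ω → ℝ := fun ω => (1 / √(T : ℝ)) * ∑ t, Z t ω with hY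
  have hmgf : ∀ σ : ℝ, |σ| = 1 → Integrable (fun ω => Real.exp (σ * (θ / 2) * Y ω)) μ ∧
      ∫ ω, Real.exp (σ * (θ / 2) * Y ω) ∂μ ≤ Real.exp (2 * K) := by
    intro σ hσ
    set ρ : ℝ := σ / √(T : ℝ) with hρ
    have hρ1 : |ρ| ≤ 1 := by
      rw [hρ, abs_div, hσ, abs_of_pos (by positivity : 0 < √(T : ℝ))]
      exact div_le_one_of_le₀ (Real.one_le_sqrt.2 hT1) (by positivity)
    have hρ2 : ρ ^ 2 * T = 1 := by
      rw [hρ, div_pow, hsT, ← sq_abs, hσ]; field_simp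
    have e : ∀ ω, σ * (θ / 2) * Y ω = ρ * (θ / 2) * (∑ t, Z t) ω := by
      intro ω; rw [hY, hρ, Finset.sum_apply]; ring
    simp_rw [e]
    have hm : mgf (∑ t, Z t) μ (ρ * (θ / 2)) ≤ Real.exp (2 * K) := by
      rw [hind.mgf_sum₀ hZm]
      calc ∏ t, mgf (Z t) μ (ρ * (θ / 2)) ≤ ∏ _t : Fin T, Real.exp (2 * ρ ^ 2 * K) :=
            Finset.prod_le_prod (fun t _ => mgf_nonneg)
              fun t _ => ((hZ t).mgf_le (hZm t) hθ hρ1).2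
        _ = Real.exp (2 * K) := by
            rw [Finset.prod_const, Finset.card_univ, Fintype.card_fin, ← Real.exp_nat_mul]
            congr 1; linear_combination (2 * K) * hρ2
    refine ⟨?_, hm⟩
    -- Under a probability measure the mgf is positive exactly when the exponential is integrable,
    -- so integrability passes through the product formula.
    rw [← mgf_pos_iff, hind.mgf_sum₀ hZm]
    exact Finset.prod_pos fun t _ => mgf_pos_iff.2 ((hZ t).mgf_le (hZm t) hθ hρ1).1
  obtain ⟨hp, hp'⟩ := hmgf 1 (by simp)
  obtain ⟨hn, hn'⟩ := hmgf (-1) (by simp)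
  simp only [one_mul] at hp hp'
  simp only [neg_mul, one_mul] at hn hn'
  have hYm : AEMeasurable Y μ := by fun_prop
  have hb : ∀ ω, Real.exp (θ / 2 * |Y ω|)
      ≤ Real.exp (θ / 2 * Y ω) + Real.exp (-(θ / 2 * Y ω)) := fun ω => by
    have := exp_mul_abs_le (θ := θ / 2) (Y ω)
    rwa [neg_mul] at this
  have hI : Integrable (fun ω => Real.exp (θ / 2 * |Y ω|)) μ :=
    (hp.add hn).mono' (by fun_prop) (ae_of_all _ fun ω => by
      rw [Real.norm_of_nonneg (Real.exp_pos _).le]; exact hb ω)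
  have hmom := integral_and_integral_sq_sum_of_indep hind
    (fun t => memLp_two_of_integrable_exp hθ (hZm t) (hZ t).integrable_exp)
    (fun t => (hZ t).integral_eq_zero) (fun t => (hZ t).integral_sq) fun _ => 1 / √(T : ℝ)
  simp_rw [← Finset.mul_sum] at hmom
  refine ⟨hI, ?_, hmom.1, ?_⟩
  · refine (integral_mono hI (hp.add hn) hb).trans ?_
    rw [integral_add' hp hn]
    linarith
  · rw [hY, hmom.2, Finset.sum_const, Finset.card_univ, Fintype.card_fin, div_pow, hsT,
      nsmul_eq_mul, one_pow, mul_one_div_cancel hT0.ne']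

/-! ### Deviation of the empirical second moment -/

/-- The truncated square is at most `R |Y|`, so its exponential is controlled by `exp (θ |Y| / 2)`;
the other half of the exponential moment pays for `Y⁴`, whence `384 = 24 · 2⁴`. The first-order term
uses `Y²` itself, so truncation does not shift the centring. -/
theorem IsStandardSubexp.mgf_sq_trunc_le {Y : Ω → ℝ} {θ K : ℝ} (hY : IsStandardSubexp Y θ K μ)
    (hYm : AEMeasurable Y μ) (hθ : 0 < θ) {l R : ℝ} (hl : 0 ≤ l) (hR : 0 ≤ R)
    (hlR : l * R ≤ θ / 2) :
    mgf (fun ω => min (Y ω ^ 2) (R ^ 2)) μ l ≤ Real.exp (l + l ^ 2 * (384 * K / θ ^ 4)) := by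
  have hsq := (memLp_two_of_integrable_exp hθ hYm hY.integrable_exp).integrable_sq
  have hb : ∀ ω, Real.exp (l * min (Y ω ^ 2) (R ^ 2))
      ≤ 1 + l * Y ω ^ 2 + l ^ 2 * (384 / θ ^ 4 * Real.exp (θ * |Y ω|)) := by
    intro ω
    set V := min (Y ω ^ 2) (R ^ 2) with hV
    have hV0 : 0 ≤ V := le_min (sq_nonneg _) (sq_nonneg _)
    have hVY : V ≤ Y ω ^ 2 := min_le_left _ _
    have hVR : V ≤ |Y ω| * R := by
      rcases le_total |Y ω| R with h | h
      · refine hVY.trans ?_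
        rw [← sq_abs, sq]; gcongr
      · refine (min_le_right _ _).trans ?_
        rw [sq]; gcongr
    -- This is `eᵘ ≤ 1 + u eᵘ`, for `u = l V ≥ 0`, inserted into itself.
    have h1 : Real.exp (l * V) ≤ 1 + l * V + (l * V) ^ 2 * Real.exp (l * V) := by
      have h := Real.add_one_le_exp (-(l * V))
      have he := Real.exp_pos (l * V)
      have hm : Real.exp (l * V) * Real.exp (-(l * V)) = 1 := by rw [← Real.exp_add]; simp
      nlinarith [mul_nonneg hl hV0, mul_le_mul_of_nonneg_left h he.le]
    have h2 : V ^ 2 * Real.exp (l * V) ≤ 384 / θ ^ 4 * Real.exp (θ * |Y ω|) := by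
      calc V ^ 2 * Real.exp (l * V) ≤ (Y ω ^ 2) ^ 2 * Real.exp (θ / 2 * |Y ω|) := by
            have : l * V ≤ θ / 2 * |Y ω| := by
              calc l * V ≤ l * (|Y ω| * R) := by gcongr
                _ = l * R * |Y ω| := by ring
                _ ≤ _ := by gcongr
            gcongr
        _ = |Y ω| ^ 4 * Real.exp (θ / 2 * |Y ω|) := by rw [← sq_abs (Y ω)]; ring
        _ ≤ 24 / (θ / 2) ^ 4 * Real.exp (θ / 2 * |Y ω|) * Real.exp (θ / 2 * |Y ω|) := by
            gcongr; exact pow_four_mul_exp_le (by positivity) (abs_nonneg _)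
        _ = _ := by
            rw [mul_assoc, ← Real.exp_add, ← add_mul, add_halves]
            congr 1; field_simp; norm_num
    calc Real.exp (l * V) ≤ 1 + l * V + l ^ 2 * (V ^ 2 * Real.exp (l * V)) := by linarith
      _ ≤ _ := by gcongr
  have h1 : Integrable (fun ω => 1 + l * Y ω ^ 2) μ := (integrable_const _).add (hsq.const_mul l)
  have h2 : Integrable (fun ω => l ^ 2 * (384 / θ ^ 4 * Real.exp (θ * |Y ω|))) μ :=
    (hY.integrable_exp.const_mul _).const_mul _
  calc mgf (fun ω => min (Y ω ^ 2) (R ^ 2)) μ l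
      ≤ ∫ ω, (1 + l * Y ω ^ 2 + l ^ 2 * (384 / θ ^ 4 * Real.exp (θ * |Y ω|))) ∂μ :=
        integral_mono_of_nonneg (ae_of_all _ fun ω => (Real.exp_pos _).le) (h1.add h2)
          (ae_of_all _ hb)
    _ = 1 + l + l ^ 2 * (384 / θ ^ 4 * ∫ ω, Real.exp (θ * |Y ω|) ∂μ) := by
        rw [integral_add h1 h2, integral_add (integrable_const _) (hsq.const_mul l),
          integral_const_mul, integral_const_mul, integral_const_mul, hY.integral_sq]
        simp
    _ ≤ 1 + l + l ^ 2 * (384 / θ ^ 4 * K) := by gcongr; exact hY.integral_exp_le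
    _ = (l + l ^ 2 * (384 * K / θ ^ 4)) + 1 := by ring
    _ ≤ _ := Real.add_one_le_exp _

/-- On the lower side `exp (-l Y²) ≤ 1`, so neither truncation nor a bound on `l` is needed. The
constant `24` is relaxed to `384` to match the upper side. -/
theorem IsStandardSubexp.mgf_neg_sq_le {Y : Ω → ℝ} {θ K : ℝ} (hY : IsStandardSubexp Y θ K μ)
    (hYm : AEMeasurable Y μ) (hθ : 0 < θ) {l : ℝ} (hl : 0 ≤ l) :
    mgf (fun ω => Y ω ^ 2) μ (-l) ≤ Real.exp (-l + l ^ 2 * (384 * K / θ ^ 4)) := by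
  have hsq := (memLp_two_of_integrable_exp hθ hYm hY.integrable_exp).integrable_sq
  have hb : ∀ ω, Real.exp (-l * Y ω ^ 2)
      ≤ 1 + -l * Y ω ^ 2 + l ^ 2 * (384 / θ ^ 4 * Real.exp (θ * |Y ω|)) := by
    intro ω
    have hu : 0 ≤ l * Y ω ^ 2 := by positivity
    have h1 : Real.exp (-l * Y ω ^ 2) ≤ 1 + -l * Y ω ^ 2 + (l * Y ω ^ 2) ^ 2 := by
      rw [neg_mul]
      rcases le_or_gt (l * Y ω ^ 2) 1 with h | h
      · have := (abs_le.1 (Real.abs_exp_sub_one_sub_id_le (x := -(l * Y ω ^ 2))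
          (by rwa [abs_neg, abs_of_nonneg hu]))).2
        linarith
      · have := Real.exp_le_one_iff.2 (by linarith : -(l * Y ω ^ 2) ≤ 0)
        nlinarith
    have h2 : (Y ω ^ 2) ^ 2 ≤ 384 / θ ^ 4 * Real.exp (θ * |Y ω|) := by
      calc (Y ω ^ 2) ^ 2 = |Y ω| ^ 4 := by rw [← sq_abs (Y ω)]; ring
        _ ≤ 24 / θ ^ 4 * Real.exp (θ * |Y ω|) := pow_four_mul_exp_le hθ (abs_nonneg _)
        _ ≤ _ := by gcongr; norm_num
    calc _ ≤ 1 + -l * Y ω ^ 2 + l ^ 2 * (Y ω ^ 2) ^ 2 := by linarith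
      _ ≤ _ := by gcongr
  have h1 : Integrable (fun ω => 1 + -l * Y ω ^ 2) μ :=
    (integrable_const _).add (hsq.const_mul _)
  have h2 : Integrable (fun ω => l ^ 2 * (384 / θ ^ 4 * Real.exp (θ * |Y ω|))) μ :=
    (hY.integrable_exp.const_mul _).const_mul _
  calc mgf (fun ω => Y ω ^ 2) μ (-l)
      ≤ ∫ ω, (1 + -l * Y ω ^ 2 + l ^ 2 * (384 / θ ^ 4 * Real.exp (θ * |Y ω|))) ∂μ :=
        integral_mono_of_nonneg (ae_of_all _ fun ω => (Real.exp_pos _).le) (h1.add h2)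
          (ae_of_all _ hb)
    _ = 1 + -l + l ^ 2 * (384 / θ ^ 4 * ∫ ω, Real.exp (θ * |Y ω|) ∂μ) := by
        rw [integral_add h1 h2, integral_add (integrable_const _) (hsq.const_mul _),
          integral_const_mul, integral_const_mul, integral_const_mul, hY.integral_sq]
        simp
    _ ≤ 1 + -l + l ^ 2 * (384 / θ ^ 4 * K) := by gcongr; exact hY.integral_exp_le
    _ = (-l + l ^ 2 * (384 * K / θ ^ 4)) + 1 := by ring
    _ ≤ _ := Real.add_one_le_exp _

/-- Deviation of the empirical second moment of independent standardized variables with an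
exponential moment, at the scale of sums of variables with stretched exponential tails. -/
theorem measureReal_abs_sum_sq_sub_ge_le {k : ℕ} {Y : Fin k → Ω → ℝ} {θ K : ℝ} (hθ : 0 < θ)
    (hind : iIndepFun Y μ) (hYm : ∀ i, AEMeasurable (Y i) μ)
    (hY : ∀ i, IsStandardSubexp (Y i) θ K μ) (hK : 0 ≤ K) {m r l : ℝ} (hm : 0 < m)
    (hmk : m ^ 4 = k) (hr : 1 ≤ r) (hl : 0 ≤ l) (hlm : 2 * l ≤ θ * m) :
    μ.real {ω | m ^ 2 * r ^ 2 ≤ |∑ i, Y i ω ^ 2 - k|}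
      ≤ (2 * Real.exp (l ^ 2 * (384 * K / θ ^ 4)) + 384 * K / θ ^ 4) * Real.exp (-(l * r)) := by
  set Q : ℝ := 384 * K / θ ^ 4 with hQ
  have hQ0 : 0 ≤ Q := by positivity
  have hr0 : 0 < r := by linarith
  -- The tilt is fixed by requiring the exponent `l r` at deviation `m² r²`. Then `lam² k ≤ l²`
  -- because `r ≥ 1`, and `lam` times the truncation level `m r` is `l / m ≤ θ / 2`.
  set lam : ℝ := l / (m ^ 2 * r) with hlam
  have hlam0 : 0 ≤ lam := by positivity
  have hlam1 : lam * (m ^ 2 * r ^ 2) = l * r := by rw [hlam]; field_simp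
  have hlam2 : lam ^ 2 * k ≤ l ^ 2 := by
    rw [hlam, ← hmk, div_pow, div_mul_eq_mul_div, div_le_iff₀ (by positivity)]
    have : 1 ≤ r ^ 2 := by nlinarith
    calc l ^ 2 * m ^ 4 = l ^ 2 * (m ^ 4 * 1) := by ring
      _ ≤ l ^ 2 * (m ^ 4 * r ^ 2) := by gcongr
      _ = _ := by ring
  have hlamR : lam * (m * r) ≤ θ / 2 := by
    have : lam * (m * r) = l / m := by rw [hlam]; field_simp
    rw [this, div_le_iff₀ hm]; linarith
  set V : Fin k → Ω → ℝ := fun i ω => min (Y i ω ^ 2) ((m * r) ^ 2) with hV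
  have hVind : iIndepFun V μ :=
    hind.comp (fun _ y => min (y ^ 2) ((m * r) ^ 2)) fun _ => by fun_prop
  have hVm : ∀ i, AEMeasurable (V i) μ := fun i => by
    have := hYm i
    fun_prop
  have hSind : iIndepFun (fun i ω => Y i ω ^ 2) μ := hind.comp (fun _ y => y ^ 2) fun _ => by fun_prop
  have hup : μ.real {ω | k + m ^ 2 * r ^ 2 ≤ (∑ i, V i) ω} ≤
      Real.exp (l ^ 2 * Q) * Real.exp (-(l * r)) := by
    refine (measure_ge_le_exp_mul_mgf _ hlam0 ?_).trans ?_
    · rw [← mgf_pos_iff, hVind.mgf_sum₀ hVm]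
      refine Finset.prod_pos fun i _ => mgf_pos ?_
      refine Integrable.of_bound (by have := hVm i; fun_prop)
        (Real.exp (lam * (m * r) ^ 2)) (ae_of_all _ fun ω => ?_)
      rw [Real.norm_of_nonneg (Real.exp_pos _).le]
      gcongr
      exact min_le_right _ _
    · rw [hVind.mgf_sum₀ hVm]
      calc _ ≤ Real.exp (-lam * (k + m ^ 2 * r ^ 2)) * ∏ _i : Fin k, Real.exp (lam + lam ^ 2 * Q) := by
            gcongr with i
            · exact fun _ _ => mgf_nonneg
            · exact (hY i).mgf_sq_trunc_le (hYm i) hθ hlam0 (by positivity) hlamR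
        _ ≤ _ := by
            rw [Finset.prod_const, Finset.card_univ, Fintype.card_fin, ← Real.exp_nat_mul,
              ← Real.exp_add, ← Real.exp_add, Real.exp_le_exp]
            nlinarith [mul_le_mul_of_nonneg_right hlam2 hQ0]
  have hlow : μ.real {ω | (∑ i, fun ω => Y i ω ^ 2) ω ≤ k - m ^ 2 * r ^ 2} ≤
      Real.exp (l ^ 2 * Q) * Real.exp (-(l * r)) := by
    refine (measure_le_le_exp_mul_mgf _ (neg_nonpos.2 hlam0) ?_).trans ?_
    · rw [← mgf_pos_iff, hSind.mgf_sum₀ (by fun_prop)]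
      refine Finset.prod_pos fun i _ => mgf_pos ?_
      refine Integrable.of_bound (by have := hYm i; fun_prop) 1 (ae_of_all _ fun ω => ?_)
      rw [Real.norm_of_nonneg (Real.exp_pos _).le, Real.exp_le_one_iff, neg_mul, neg_nonpos]
      positivity
    · rw [hSind.mgf_sum₀ (by fun_prop)]
      calc _ ≤ Real.exp (-(-lam) * (k - m ^ 2 * r ^ 2)) *
              ∏ _i : Fin k, Real.exp (-lam + lam ^ 2 * Q) := by
            gcongr with i
            · exact fun _ _ => mgf_nonneg
            · exact (hY i).mgf_neg_sq_le (hYm i) hθ hlam0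
        _ ≤ _ := by
            rw [Finset.prod_const, Finset.card_univ, Fintype.card_fin, ← Real.exp_nat_mul,
              ← Real.exp_add, ← Real.exp_add, Real.exp_le_exp]
            nlinarith [mul_le_mul_of_nonneg_right hlam2 hQ0]
  have htail : ∀ i, μ.real {ω | m * r ≤ |Y i ω|} ≤ Real.exp (-θ * (m * r)) * K := fun i =>
    (measure_ge_le_exp_mul_mgf (X := fun ω => |Y i ω|) _ hθ.le (hY i).integrable_exp).trans
      (mul_le_mul_of_nonneg_left (hY i).integral_exp_le (Real.exp_pos _).le)
  -- The exponent `θ m r` is split in halves: one, using `r ≥ 1`, absorbs the `k = m⁴` terms of the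
  -- union bound, the other dominates `l r`.
  have hmax : ∑ i, μ.real {ω | m * r ≤ |Y i ω|} ≤ Q * Real.exp (-(l * r)) := by
    calc ∑ i, μ.real {ω | m * r ≤ |Y i ω|} ≤ ∑ _i : Fin k, Real.exp (-θ * (m * r)) * K :=
          Finset.sum_le_sum fun i _ => htail i
      _ = K * (m ^ 4 * Real.exp (-θ * (m * r))) := by
          rw [Finset.sum_const, Finset.card_univ, Fintype.card_fin, nsmul_eq_mul, hmk]; ring
      _ ≤ K * (24 / (θ / 2) ^ 4 * Real.exp (θ / 2 * m) *
            Real.exp (-(θ / 2 * m) + -(l * r))) := by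
          gcongr
          · exact pow_four_mul_exp_le (by positivity) hm.le
          · nlinarith [mul_pos hθ hm]
      _ = _ := by
          rw [Real.exp_add, Real.exp_neg (θ / 2 * m), hQ]
          field_simp
          ring
  have hsub : {ω | m ^ 2 * r ^ 2 ≤ |∑ i, Y i ω ^ 2 - k|} ⊆
      ({ω | k + m ^ 2 * r ^ 2 ≤ (∑ i, V i) ω} ∪
        {ω | (∑ i, fun ω => Y i ω ^ 2) ω ≤ k - m ^ 2 * r ^ 2}) ∪ ⋃ i, {ω | m * r ≤ |Y i ω|} := by
    intro ω hω
    by_cases hb : ∃ i, m * r ≤ |Y i ω|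
    · exact Or.inr (Set.mem_iUnion.2 hb)
    · push Not at hb
      left
      have hVe : ∀ i, V i ω = Y i ω ^ 2 := fun i => min_eq_left (by
        rw [← sq_abs]; exact pow_le_pow_left₀ (abs_nonneg _) (hb i).le 2)
      rcases le_abs.1 (show m ^ 2 * r ^ 2 ≤ |∑ i, Y i ω ^ 2 - k| from hω) with h | h
      · left
        simp only [Set.mem_ofPred_eq, Finset.sum_apply, hVe]; linarith
      · right
        simp only [Set.mem_ofPred_eq, Finset.sum_apply]; linarith
  refine (measureReal_mono hsub).trans ?_
  refine (measureReal_union_le _ _).trans ?_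
  have h1 := measureReal_union_le (μ := μ) {ω | k + m ^ 2 * r ^ 2 ≤ (∑ i, V i) ω}
    {ω | (∑ i, fun ω => Y i ω ^ 2) ω ≤ k - m ^ 2 * r ^ 2}
  have h2 := measureReal_iUnion_fintype_le (μ := μ) fun i => {ω | m * r ≤ |Y i ω|}
  linarith

end

/-! ### The projection as an empirical second moment -/

section

theorem trpReplicates_apply {T d₁ d₂ k : ℕ} (A : Fin T → Matrix (Fin d₁) (Fin k) ℝ)
    (B : Fin T → Matrix (Fin d₂) (Fin k) ℝ) (x : EuclideanSpace ℝ (Fin d₁ × Fin d₂)) (i : Fin k) :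
    trpReplicates A B x i = (1 / √(k : ℝ)) * ((1 / √(T : ℝ)) *
      ∑ t, bilinearChaos (fun a b => x (a, b)) (fun a => A t a i, fun b => B t b i)) := by
  simp only [trpReplicates, trp, bilinearChaos, khatriRao, PiLp.smul_apply, WithLp.ofLp_sum,
    Finset.sum_apply, Pi.smul_apply, smul_eq_mul, Matrix.mulVec, dotProduct, Matrix.transpose_apply,
    Matrix.of_apply, Fintype.sum_prod_type_right]
  rw [← Finset.mul_sum, mul_left_comm]
  congr 3
  refine funext fun t => Finset.sum_congr rfl fun b _ => ?_
  rw [Finset.sum_mul]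
  exact Finset.sum_congr rfl fun a _ => by ring

theorem bilinearChaos_smul {I J : Type*} [Fintype I] [Fintype J] (r : ℝ) (c : I → J → ℝ)
    (p : (I → ℝ) × (J → ℝ)) :
    bilinearChaos (fun a b => r * c a b) p = r * bilinearChaos c p := by
  simp only [bilinearChaos, Finset.mul_sum, Finset.sum_mul, mul_assoc]

/-- The relative error of the squared norm as the deviation of an empirical second moment. -/
theorem norm_sq_trpReplicates_sub {T d₁ d₂ k : ℕ} (hk : 1 ≤ k)
    (A : Fin T → Matrix (Fin d₁) (Fin k) ℝ) (B : Fin T → Matrix (Fin d₂) (Fin k) ℝ)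
    {x : EuclideanSpace ℝ (Fin d₁ × Fin d₂)} (hx : x ≠ 0) :
    ‖trpReplicates A B x‖ ^ 2 - ‖x‖ ^ 2 = ‖x‖ ^ 2 / k * (∑ i, ((1 / √(T : ℝ)) *
      ∑ t, bilinearChaos (fun a b => ‖x‖⁻¹ * x (a, b))
        (fun a => A t a i, fun b => B t b i)) ^ 2 - k) := by
  have hk0 : (0 : ℝ) < k := by exact_mod_cast hk
  have hx0 : 0 < ‖x‖ := norm_pos_iff.2 hx
  rw [mul_sub, div_mul_cancel₀ _ hk0.ne']
  congr 1
  rw [EuclideanSpace.real_norm_sq_eq, Finset.mul_sum]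
  refine Finset.sum_congr rfl fun i _ => ?_
  rw [trpReplicates_apply]
  simp_rw [bilinearChaos_smul]
  rw [← Finset.mul_sum, mul_pow, div_pow, Real.sq_sqrt hk0.le, mul_left_comm, mul_pow (‖x‖⁻¹)]
  field_simp

/-- The index of an entry of the `t`-th pair of factors that lies in the `i`-th column. -/
def columnEntry {T d₁ d₂ k : ℕ} : (Fin k × Fin T) × (Fin d₁ ⊕ Fin d₂) →
    Fin T × ((Fin d₁ × Fin k) ⊕ (Fin d₂ × Fin k))
  | ((i, t), Sum.inl a) => (t, Sum.inl (a, i))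
  | ((i, t), Sum.inr b) => (t, Sum.inr (b, i))

theorem columnEntry_injective {T d₁ d₂ k : ℕ} :
    Function.Injective (columnEntry (T := T) (d₁ := d₁) (d₂ := d₂) (k := k)) := by
  rintro ⟨⟨i, t⟩, a | b⟩ ⟨⟨i', t'⟩, a' | b'⟩ h <;> simp_all [columnEntry]

variable {Ω : Type*} [MeasurableSpace Ω] {μ : Measure Ω} [IsProbabilityMeasure μ]

/-- The coordinates of the normalized projection are independent standardized variables with an
exponential moment. -/
theorem indep_and_isStandardSubexp_coord {ν : Measure ℝ} [IsProbabilityMeasure ν]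
    {s : ℝ} (hs : 0 < s) (hν : HasSubgaussianMGF id s.toNNReal ν) (hν0 : ∫ y, y ∂ν = 0)
    (hν1 : ∫ y, y ^ 2 ∂ν = 1) {d₁ d₂ k T : ℕ} (hT : 1 ≤ T)
    {A : Fin T → Ω → Matrix (Fin d₁) (Fin k) ℝ} {B : Fin T → Ω → Matrix (Fin d₂) (Fin k) ℝ}
    (hind : iIndepFun (factorEntries A B) μ) (hlaw : ∀ j, HasLaw (factorEntries A B j) ν μ)
    {c : Fin d₁ → Fin d₂ → ℝ} (hc : ∑ a, ∑ b, c a b ^ 2 = 1) {Y : Fin k → Ω → ℝ}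
    (hY : Y = fun i ω => (1 / √(T : ℝ)) *
      ∑ t, bilinearChaos c (fun a => A t ω a i, fun b => B t ω b i)) :
    iIndepFun Y μ ∧ (∀ i, AEMeasurable (Y i) μ) ∧
      ∀ i, IsStandardSubexp (Y i) (1 / (4 * s)) (2 * Real.exp 6) μ := by
  subst hY
  have hcm := measurable_bilinearChaos c
  have hstd := isStandardSubexp_bilinearChaos hs hν hν0 hν1 hc
  set Q := (Measure.pi fun _ : Fin d₁ => ν).prod (Measure.pi fun _ : Fin d₂ => ν) with hQ
  set W : Fin k × Fin T → Ω → (Fin d₁ → ℝ) × (Fin d₂ → ℝ) :=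
    fun p ω => (fun a => A p.2 ω a p.1, fun b => B p.2 ω b p.1) with hW
  -- Reindexing by column and replicate first makes each factor pair one row of a curried family.
  set X : (Fin k × Fin T) × (Fin d₁ ⊕ Fin d₂) → Ω → ℝ :=
    fun q => factorEntries A B (columnEntry q) with hX
  have hXind : iIndepFun X μ := hind.precomp columnEntry_injective
  have hXlaw : ∀ q, HasLaw (X q) ν μ := fun q => hlaw _
  have hrow : iIndepFun (fun p ω j => X (p, j) ω) μ := iIndepFun_curry hXind hXlaw
  have hWind : iIndepFun W μ :=
    hrow.comp (fun _ => MeasurableEquiv.sumPiEquivProdPi fun _ : Fin d₁ ⊕ Fin d₂ => ℝ)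
      fun _ => MeasurableEquiv.measurable _
  have hWlaw : ∀ p, HasLaw (W p) Q μ := fun p =>
    (measurePreserving_sumPiEquivProdPi fun _ : Fin d₁ ⊕ Fin d₂ => ν).fun_comp_hasLaw
      ((hXind.precomp (g := fun j => (p, j)) (Prod.mk_right_injective p)).hasLaw_pi
        fun j => hXlaw (p, j))
  set Z : Fin k × Fin T → Ω → ℝ := fun p ω => bilinearChaos c (W p ω) with hZ
  have hZind : iIndepFun Z μ := hWind.comp (fun _ => bilinearChaos c) fun _ => hcm
  have hZlaw : ∀ p, HasLaw (Z p) (Q.map (bilinearChaos c)) μ := fun p =>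
    (hcm.measurePreserving Q).fun_comp_hasLaw (hWlaw p)
  have hZm : ∀ p, AEMeasurable (Z p) μ := fun p => (hZlaw p).aemeasurable
  have : IsProbabilityMeasure (Q.map (bilinearChaos c)) :=
    Measure.isProbabilityMeasure_map hcm.aemeasurable
  refine ⟨(iIndepFun_curry hZind hZlaw).comp (fun _ z => (1 / √(T : ℝ)) * ∑ t, z t)
    fun _ => by fun_prop, fun i => ?_, fun i => ?_⟩
  · exact (Finset.aemeasurable_fun_sum _ fun t _ => hZm (i, t)).const_mul _
  · have := isStandardSubexp_normalized_sum hT (Z := fun t => Z (i, t)) (by positivity)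
      (hZind.precomp (g := fun t => (i, t)) (Prod.mk_right_injective i)) (fun t => hZm (i, t))
      fun t => hstd.comp_hasLaw hcm (hWlaw (i, t))
    convert this using 1
    · field_simp; norm_num
    · norm_num

end

/-! ### Choice of the rate -/

/-- The deviation bound with an arbitrary rate `l`, as soon as `k` is large compared to it. -/
theorem measureReal_trpReplicates_le {φ : ℝ} (hφ : 0 < φ) {l : ℝ} (hl : 0 ≤ l) :
    ∃ C : ℝ, 0 < C ∧ ∀ (ν : Measure ℝ) [IsProbabilityMeasure ν],
        ∫ y, y ∂ν = 0 → ∫ y, y ^ 2 ∂ν = 1 → subGaussianNorm id ν ≤ ENNReal.ofReal φ →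
      ∀ (d₁ d₂ k T : ℕ), 1 ≤ k → 1 ≤ T → 2304 * φ ^ 2 * l ≤ (k : ℝ) ^ (1 / 4 : ℝ) →
      ∀ (Ω : Type*) [MeasurableSpace Ω] (μ : Measure Ω) [IsProbabilityMeasure μ]
        (A : Fin T → Ω → Matrix (Fin d₁) (Fin k) ℝ) (B : Fin T → Ω → Matrix (Fin d₂) (Fin k) ℝ),
        iIndepFun (factorEntries A B) μ → (∀ j, HasLaw (factorEntries A B j) ν μ) →
      ∀ x : EuclideanSpace ℝ (Fin d₁ × Fin d₂), x ≠ 0 → ∀ ε : ℝ, 0 < ε →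
        μ.real {ω | ε * ‖x‖ ^ 2 ≤
            |‖trpReplicates (fun t => A t ω) (fun t => B t ω) x‖ ^ 2 - ‖x‖ ^ 2|}
          ≤ C * Real.exp (-(l * (√(k : ℝ) * ε) ^ (1 / 2 : ℝ))) := by
  set s : ℝ := 288 * φ ^ 2 with hs
  have hs0 : 0 < s := by positivity
  set θ : ℝ := 1 / (4 * s) with hθ
  have hθ0 : 0 < θ := by positivity
  set K : ℝ := 2 * Real.exp 6 with hK
  set D : ℝ := 2 * Real.exp (l ^ 2 * (384 * K / θ ^ 4)) + 384 * K / θ ^ 4 with hD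
  have hD0 : 0 < D := by positivity
  -- `D` is the constant of the deviation bound for `r ≥ 1`; `exp l` makes the claim trivial for `r
  -- < 1`.
  refine ⟨D + Real.exp l, by positivity, ?_⟩
  intro ν _ hν0 hν1 hνφ d₁ d₂ k T hk hT hkl Ω _ μ _ A B hind hlaw x hx ε hε
  have hk0 : (0 : ℝ) < k := by exact_mod_cast hk
  have hx0 : 0 < ‖x‖ := norm_pos_iff.2 hx
  set r : ℝ := (√(k : ℝ) * ε) ^ (1 / 2 : ℝ) with hr
  have hr0 : 0 < r := by positivity
  have hr2 : r ^ 2 = √(k : ℝ) * ε := by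
    rw [hr, ← Real.rpow_natCast, ← Real.rpow_mul (by positivity)]; norm_num
  set m : ℝ := (k : ℝ) ^ (1 / 4 : ℝ) with hm
  have hm0 : 0 < m := by positivity
  have hm4 : m ^ 4 = k := by
    rw [hm, ← Real.rpow_natCast, ← Real.rpow_mul (by positivity)]; norm_num
  have hm2 : m ^ 2 = √(k : ℝ) := by
    rw [← hm4, show m ^ 4 = (m ^ 2) ^ 2 by ring, Real.sqrt_sq (by positivity)]
  rcases lt_or_ge r 1 with hr1 | hr1
  · refine measureReal_le_one.trans ?_
    calc (1 : ℝ) ≤ Real.exp (l + -(l * r)) := by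
          rw [Real.one_le_exp_iff]; nlinarith
      _ = Real.exp l * Real.exp (-(l * r)) := Real.exp_add _ _
      _ ≤ _ := by gcongr; linarith
  -- A non-integrable function would have integral `0`, so the second moment being `1` already gives
  -- integrability.
  · have hL : MemLp id 2 ν := (memLp_two_iff_integrable_sq (by fun_prop)).2
      (Integrable.of_integral_ne_zero (by simp [hν1]))
    have hνs : HasSubgaussianMGF id s.toNNReal ν :=
      hasSubgaussianMGF_of_subGaussianNorm_le (by fun_prop) (hL.integrable (by norm_num)) hν0 hφ hνφ
    have hc : ∑ a, ∑ b, (‖x‖⁻¹ * x (a, b)) ^ 2 = 1 := by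
      rw [← Fintype.sum_prod_type' (f := fun a b => (‖x‖⁻¹ * x (a, b)) ^ 2)]
      simp_rw [mul_pow]
      rw [← Finset.mul_sum, ← EuclideanSpace.real_norm_sq_eq, ← mul_pow,
        inv_mul_cancel₀ hx0.ne', one_pow]
    obtain ⟨hYi, hYm, hY⟩ := indep_and_isStandardSubexp_coord hs0 hνs hν0 hν1 hT hind hlaw hc rfl
    have key := measureReal_abs_sum_sq_sub_ge_le hθ0 hYi hYm hY (by positivity) hm0 hm4 hr1 hl (by
      rw [hθ, hs, div_mul_eq_mul_div, one_mul, le_div_iff₀ (by positivity)]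
      linarith)
    refine le_trans (le_of_eq ?_) (key.trans ?_)
    · congr 1
      ext ω
      rw [Set.mem_ofPred_eq, Set.mem_ofPred_eq, norm_sq_trpReplicates_sub hk _ _ hx, abs_mul,
        abs_of_pos (by positivity : 0 < ‖x‖ ^ 2 / k), hr2, hm2, ← mul_assoc,
        Real.mul_self_sqrt hk0.le, div_mul_eq_mul_div, le_div_iff₀ hk0,
        show ε * ‖x‖ ^ 2 * k = ‖x‖ ^ 2 * (k * ε) by ring]
      exact mul_le_mul_iff_right₀ (by positivity)
    · exact mul_le_mul_of_nonneg_right (show D ≤ D + Real.exp l by linarith [Real.exp_pos l])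
        (Real.exp_pos _).le

theorem mainTheorem3 :
    ∃ c₁ : ℝ, 0 < c₁ ∧ ∀ φ : ℝ, 0 < φ → ∃ C : ℝ, 0 < C ∧
      ∀ (ν : Measure ℝ) [IsProbabilityMeasure ν],
        ∫ y, y ∂ν = 0 → ∫ y, y ^ 2 ∂ν = 1 → subGaussianNorm id ν ≤ ENNReal.ofReal φ →
      ∀ (d₁ d₂ k T : ℕ), 1 ≤ k → 1 ≤ T →
      ∀ (Ω : Type*) [MeasurableSpace Ω] (μ : Measure Ω) [IsProbabilityMeasure μ]
        (A : Fin T → Ω → Matrix (Fin d₁) (Fin k) ℝ) (B : Fin T → Ω → Matrix (Fin d₂) (Fin k) ℝ),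
        iIndepFun (factorEntries A B) μ → (∀ j, HasLaw (factorEntries A B j) ν μ) →
      ∀ x : EuclideanSpace ℝ (Fin d₁ × Fin d₂), x ≠ 0 → ∀ ε : ℝ, 0 < ε →
        (ε ≤ 1 →
          μ.real {ω | ε * ‖x‖ ^ 2 ≤
              |‖trpReplicates (fun t => A t ω) (fun t => B t ω) x‖ ^ 2 - ‖x‖ ^ 2|}
            ≤ C * Real.exp (-(c₁ * (√(k : ℝ) * ε) ^ (1 / 2 : ℝ)))) ∧
        μ.real {ω | ε * ‖x‖ ^ 2 ≤
            |‖trpReplicates (fun t => A t ω) (fun t => B t ω) x‖ ^ 2 - ‖x‖ ^ 2|}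
          ≤ C * Real.exp (-(c₁ / φ ^ 2 * (√(k : ℝ) * ε) ^ (1 / 2 : ℝ))) := by
  -- With `θ = 1 / (1152 φ²)`, the condition `2 l ≤ θ m` reads `2304 φ² l ≤ k^(1/4)`: it becomes `φ²
  -- ≤ k^(1/4)` for `l = 1/2304`, and `1 ≤ k^(1/4)` after division of `l` by `φ²`.
  refine ⟨1 / 2304, by norm_num, fun φ hφ => ?_⟩
  obtain ⟨C₁, hC₁, h₁⟩ := measureReal_trpReplicates_le hφ (l := 1 / 2304) (by norm_num)
  obtain ⟨C₂, hC₂, h₂⟩ := measureReal_trpReplicates_le hφ (l := 1 / 2304 / φ ^ 2) (by positivity)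
  refine ⟨C₁ + C₂ + Real.exp (φ ^ 2), by positivity, ?_⟩
  intro ν _ hν0 hν1 hνφ d₁ d₂ k T hk hT Ω _ μ _ A B hind hlaw x hx ε hε
  have hk1 : (1 : ℝ) ≤ k := by exact_mod_cast hk
  constructor
  · intro hε1
    rcases le_or_gt (φ ^ 2) ((k : ℝ) ^ (1 / 4 : ℝ)) with h | h
    · refine (h₁ ν hν0 hν1 hνφ d₁ d₂ k T hk hT (by linarith) Ω μ A B hind hlaw x hx ε hε).trans ?_
      gcongr
      linarith [Real.exp_pos (φ ^ 2)]
    · have hr : (√(k : ℝ) * ε) ^ (1 / 2 : ℝ) ≤ φ ^ 2 := by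
        calc (√(k : ℝ) * ε) ^ (1 / 2 : ℝ) ≤ (√(k : ℝ) * 1) ^ (1 / 2 : ℝ) := by gcongr
          _ = (k : ℝ) ^ (1 / 4 : ℝ) := by
              rw [mul_one, Real.sqrt_eq_rpow, ← Real.rpow_mul (by positivity)]; norm_num
          _ ≤ φ ^ 2 := h.le
      have hr0 : 0 ≤ (√(k : ℝ) * ε) ^ (1 / 2 : ℝ) := by positivity
      refine measureReal_le_one.trans ?_
      calc (1 : ℝ) ≤ Real.exp (φ ^ 2 + -(1 / 2304 * (√(k : ℝ) * ε) ^ (1 / 2 : ℝ))) := by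
            rw [Real.one_le_exp_iff]; linarith
        _ = Real.exp (φ ^ 2) * Real.exp (-(1 / 2304 * (√(k : ℝ) * ε) ^ (1 / 2 : ℝ))) :=
            Real.exp_add _ _
        _ ≤ _ := by gcongr; linarith
  · refine (h₂ ν hν0 hν1 hνφ d₁ d₂ k T hk hT ?_ Ω μ A B hind hlaw x hx ε hε).trans ?_
    · calc 2304 * φ ^ 2 * (1 / 2304 / φ ^ 2) = 1 := by field_simp
        _ ≤ _ := Real.one_le_rpow hk1 (by norm_num)
    · gcongr
      linarith [Real.exp_pos (φ ^ 2)]
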